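/- Let $\mu\ge 0$. A squared Bessel process of index $\mu$ (BESQ($\mu$), i.e. of dimension $2(\mu+1)$) started at $x\ge 0$ is a process $R=(R(t))_{t\ge 0}$ with continuous paths and $R(0)=x$ a.s., Markov with respect to its own filtration, with transition function $Q_t(x,dy)=q_t(x,y)\,dy$ on $(0,\infty)$ for $t>0$ (and $Q_0(x,\cdot)=\delta_x$), where $$q_t(x,y)=\frac1{2t}\Big(\frac yx\Big)^{\mu/2}e^{-\frac{x+y}{2t}}I_\mu\Big(\frac{\sqrt{xy}}t\Big)\quad(x>0),\qquad q_t(0,y)=\frac{y^{\mu}e^{-y/(2t)}}{(2t)^{\mu+1}\Gamma(\mu+1)},$$ and $I_\mu$ is the modified Bessel function of the first kind. Let $R$ be a BESQ($\mu$) started at $1$ on a probability space with measure $\mathbb P$, and let $(\mathcal F_t)_{t\ge0}$ be the filtration generated by $R$, augmented by the $\mathbb P$-null events and made right-continuous. Fix $a\ge 0$ and put, for $t\ge0$, $$X(t,a)=\frac{R(t+aR(t))}{R(t)} .$$ (1) Let $v\ge 0$, $t\ge 0$, not both zero, let $R^{v^2}$ be a BESQ($\mu$) started at $v^2$ (on any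 probability space), and let $X^{v^2}(t,a)=R^{v^2}(t+aR^{v^2}(t))/R^{v^2}(t)$. Then $X^{v^2}(t,a)$ has the same law as $R(a)$; that is, $\mathbb E f(X^{v^2}(t,a))=\mathbb E f(R(a))$ for every nonnegative Borel function $f$. (2) For every $t\ge 0$, $X(t,a)$ has the same law as $R(a)$, and $X(t,a)$ is independent of $\mathcal F_t$. (3) Let $\tau$ be an $(\mathcal F_t)$-stopping time with values in $[0,\infty]$, let $\mathcal F_\tau$ be its $\sigma$-algebra, and let $X(\tau,a)=R(\tau+aR(\tau))/R(\tau)$ on $\{\tau<\infty\}$. If $\tau<\infty$ a.s., then $X(\tau,a)$ has the same law as $R(a)$ and is independent of $\mathcal F_\tau$. In general, $$\mathbb P\big(A\cap\{\tau<\infty\}\cap\{X(\tau,a)\in B\}\big)=\mathbb P\big(A\cap\{\tau<\infty\}\big)\,\mathbb P\big(R(a)\in B\big)$$ for all $A\in\mathcal F_\tau$ and all Borel sets $B\subset\mathbb R$. -/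

import Mathlib

open MeasureTheory ProbabilityTheory
open scoped NNReal ENNReal

noncomputable section

/-- The modified Bessel function of the first kind `I_μ(z)` for real `z > 0`:
`I_μ(z) = ∑_{k ≥ 0} (z/2)^(2k+μ) / (k! Γ(μ+k+1))`. -/
def besselI (μ z : ℝ) : ℝ :=
  ∑' k : ℕ, (z / 2) ^ (2 * (k : ℝ) + μ) / ((k.factorial : ℝ) * Real.Gamma (μ + k + 1))

/-- The transition density `q_t(x, y)`, for `t > 0`, `x ≥ 0`, `y > 0`, of the squared Bessel
process of index `μ` (that is, of dimension `2(μ + 1)`):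
`q_t(x, y) = (1/2t) (y/x)^(μ/2) exp(-(x+y)/2t) I_μ(√(xy)/t)` for `x > 0`, and
`q_t(0, y) = (2t)^(-(μ+1)) Γ(μ+1)⁻¹ y^μ exp(-y/2t)`. -/
def besqDensity (μ t x y : ℝ) : ℝ :=
  if x = 0 then
    (2 * t) ^ (-(μ + 1)) * (Real.Gamma (μ + 1))⁻¹ * y ^ μ * Real.exp (-y / (2 * t))
  else
    1 / (2 * t) * (y / x) ^ (μ / 2) * Real.exp (-(x + y) / (2 * t)) * besselI μ (√(x * y) / t)

/-- The transition function `Q_t(x, dy)` of the squared Bessel process of index `μ`. It is carried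
by `[0, ∞)`; the values for `x < 0` are irrelevant. -/
def besqTransition (μ : ℝ) (t : ℝ≥0) (x : ℝ) : Measure ℝ :=
  if t = 0 then Measure.dirac x
  else (volume.restrict (Set.Ioi (0 : ℝ))).withDensity
    fun y => ENNReal.ofReal (besqDensity μ (t : ℝ) x y)

variable {Ω : Type*} {m : MeasurableSpace Ω}

/-- `R` is, under `P`, a squared Bessel process of index `μ` started at `x ≥ 0`: a process with
continuous paths and `R 0 = x` almost surely that is Markov, with respect to its own filtration
`σ(R u : u ≤ s)`, with the transition function of the squared Bessel process. -/
structure IsBESQ (μ x : ℝ) (R : ℝ≥0 → Ω → ℝ) (P : Measure Ω) : Prop where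
  measurable : ∀ t, Measurable (R t)
  continuous : ∀ ω, Continuous fun t => R t ω
  start : ∀ᵐ ω ∂P, R 0 ω = x
  markov : ∀ (s t : ℝ≥0) (B : Set ℝ), MeasurableSet B →
    P⟦R (s + t) ⁻¹' B | Filtration.natural R (fun u => (measurable u).stronglyMeasurable) s⟧
      =ᵐ[P] fun ω => (besqTransition μ t (R s ω)).real B

/-- The usual augmentation of a filtration: adjoin all `P`-null events to every `𝓕 t`, and pass to
the right-continuous version `⋂_{s > t}`. (The null events are those of the ambient σ-algebra `m`;
if `P` is complete on `m`, the result satisfies the usual conditions.) -/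
def usualAugmentation (P : Measure Ω) (𝓕 : Filtration ℝ≥0 m) : Filtration ℝ≥0 m :=
  Filtration.rightCont
    { seq := fun t => 𝓕 t ⊔ MeasurableSpace.generateFrom {N | MeasurableSet[m] N ∧ P N = 0}
      mono' := fun _ _ hst => sup_le_sup_right (𝓕.mono hst) _
      le' := fun t => sup_le (𝓕.le t) (MeasurableSpace.generateFrom_le fun _ hN => hN.1) }

/-- The filtration `(𝓕^R_t)` generated by a squared Bessel process and augmented so as to satisfy
the usual conditions. -/
def IsBESQ.filtration {μ x : ℝ} {R : ℝ≥0 → Ω → ℝ} {P : Measure Ω} (hR : IsBESQ μ x R P) :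
    Filtration ℝ≥0 m :=
  usualAugmentation P (Filtration.natural R fun u => (hR.measurable u).stronglyMeasurable)

/-- The Bessel time process `X(t, a) = R(t + a R(t)) / R(t)`. A squared Bessel process is almost
surely nonnegative, so `toNNReal` only matters on a null event. -/
def besselTime (R : ℝ≥0 → Ω → ℝ) (t a : ℝ≥0) (ω : Ω) : ℝ :=
  R (t + a * (R t ω).toNNReal) ω / R t ω

/-- `X(τ, a) = R(τ + a R(τ)) / R(τ)` for a random time `τ` (of interest on `{τ < ∞}` only). -/
def besselTimeAt (R : ℝ≥0 → Ω → ℝ) (τ : Ω → WithTop ℝ≥0) (a : ℝ≥0) (ω : Ω) : ℝ :=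
  besselTime R ((τ ω).untopD 0) a ω

end

/-!
The transition function is a Poisson mixture of Gamma laws, which yields its Laplace transform
`∫ e^{-l y} Q_t(x, dy) = (1 + 2 t l)^{-(μ + 1)} e^{-x l / (1 + 2 t l)}` and hence that it is a
Markov kernel. By Brownian scaling, `Q_{ct}(cx, ·)` is the image of `Q_t(x, ·)` under `y ↦ c y`.

If `R(τ) > 0`, then conditionally on the past of `τ` the level `c = R(τ)` is a constant, so the
Markov property and scaling make `R(τ + a c) / c` a squared Bessel variable started at `1` and
observed at time `a`, whatever the past. For a general stopping time, discretise `τ` from the right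
and use path continuity.

It remains to see that the process never hits `0`. Up to constants, the `1`-resolvent density at `0`
is `G(x) = ∫₀^∞ e^{-r} r^{-(μ + 1)} e^{-x / (2r)} dr`. Then `e^{-t} G(R(t))` is a nonnegative
supermartingale which would explode at a zero of `R`, because `G(0) = ∞` exactly when `μ ≥ 0`; the
maximal inequality rules this out.
-/

open Filter Topology Set

section TransitionFunction

variable {μ : ℝ}

lemma summable_besselI (hμ : -1 < μ) {z : ℝ} (hz : 0 < z) :
    Summable fun k : ℕ =>
      (z / 2) ^ (2 * (k : ℝ) + μ) / ((k.factorial : ℝ) * Real.Gamma (μ + k + 1)) := by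
  have hΓ (k : ℕ) : 0 < Real.Gamma (μ + k + 1) :=
    Real.Gamma_pos_of_pos (by linarith [k.cast_nonneg (α := ℝ)])
  have hpos (k : ℕ) : 0 < (z / 2) ^ (2 * (k : ℝ) + μ) / ((k.factorial : ℝ) *
      Real.Gamma (μ + k + 1)) := by
    have := hΓ k
    positivity
  refine summable_of_ratio_test_tendsto_lt_one zero_lt_one (.of_forall fun k => (hpos k).ne') ?_
  have ratio (k : ℕ) : ‖(z / 2) ^ (2 * ((k + 1 : ℕ) : ℝ) + μ) / (((k + 1).factorial : ℝ) *
      Real.Gamma (μ + (k + 1 : ℕ) + 1))‖ / ‖(z / 2) ^ (2 * (k : ℝ) + μ) / ((k.factorial : ℝ) *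
      Real.Gamma (μ + k + 1))‖ = (z / 2) ^ 2 / (μ + k + 1) * (1 / ((k : ℝ) + 1)) := by
    have hk : 0 < μ + k + 1 := by linarith [k.cast_nonneg (α := ℝ)]
    have hpow : (z / 2) ^ (2 * ((k + 1 : ℕ) : ℝ) + μ) =
        (z / 2) ^ (2 * (k : ℝ) + μ) * (z / 2) ^ 2 := by
      rw [← Real.rpow_natCast (z / 2) 2, ← Real.rpow_add (by positivity)]
      push_cast
      ring_nf
    have hΓ_succ : Real.Gamma (μ + (k + 1 : ℕ) + 1) = (μ + k + 1) * Real.Gamma (μ + k + 1) := by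
      rw [← Real.Gamma_add_one hk.ne']
      push_cast
      ring_nf
    rw [Real.norm_of_nonneg (hpos _).le, Real.norm_of_nonneg (hpos _).le, hpow, hΓ_succ,
      Nat.factorial_succ]
    have := (hΓ k).ne'
    have : (z / 2) ^ (2 * (k : ℝ) + μ) ≠ 0 := by positivity
    push_cast
    field_simp
  simp only [ratio]
  have hlim : Tendsto (fun k : ℕ => μ + k + 1) atTop atTop :=
    tendsto_atTop_add_const_right _ _ (tendsto_atTop_add_const_left _ _ tendsto_natCast_atTop_atTop)
  simpa using (hlim.const_div_atTop ((z / 2) ^ 2)).mul tendsto_one_div_add_atTop_nhds_zero_nat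

lemma besselI_term_eq_poisson_mul_gamma (hμ : -1 < μ) {b x y : ℝ} (hb : 0 < b) (hx : 0 < x)
    (hy : 0 < y) (k : ℕ) :
    b * (y / x) ^ (μ / 2) * Real.exp (-(x + y) * b) *
        ((√(x * y) * b) ^ (2 * (k : ℝ) + μ) / ((k.factorial : ℝ) * Real.Gamma (μ + k + 1))) =
      Real.exp (-(x * b)) * (x * b) ^ k / k.factorial * gammaPDFReal (μ + k + 1) b y := by
  have hk : 0 < μ + k + 1 := by linarith [k.cast_nonneg (α := ℝ)]
  have hΓ : Real.Gamma (μ + k + 1) ≠ 0 := (Real.Gamma_pos_of_pos hk).ne'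
  have hpow : (√(x * y) * b) ^ (2 * (k : ℝ) + μ) =
      (x ^ k * x ^ (μ / 2)) * (y ^ k * y ^ (μ / 2)) * (b ^ k * b ^ k * b ^ μ) := by
    rw [Real.mul_rpow (Real.sqrt_nonneg _) hb.le, Real.sqrt_eq_rpow,
      ← Real.rpow_mul (by positivity), show 1 / 2 * (2 * (k : ℝ) + μ) = k + μ / 2 by ring,
      Real.mul_rpow hx.le hy.le, show 2 * (k : ℝ) + μ = k + k + μ by ring]
    simp only [Real.rpow_add, hx, hy, hb, Real.rpow_natCast]
  have hb_pow : b ^ (μ + k + 1) = b ^ μ * b ^ k * b := by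
    simp only [Real.rpow_add hb, Real.rpow_natCast, Real.rpow_one]
  have hy_pow : y ^ (μ + k + 1 - 1) = y ^ (μ / 2) * y ^ (μ / 2) * y ^ k := by
    rw [show μ + k + 1 - 1 = μ / 2 + μ / 2 + k by ring]
    simp only [Real.rpow_add hy, Real.rpow_natCast]
  have hexp : Real.exp (-(x + y) * b) = Real.exp (-(x * b)) * Real.exp (-(b * y)) := by
    rw [← Real.exp_add]
    ring_nf
  have hx_pow : x ^ (μ / 2) ≠ 0 := by positivity
  rw [gammaPDFReal, if_pos hy.le, hpow, hb_pow, hy_pow, hexp, Real.div_rpow hy.le hx.le, mul_pow]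
  field_simp

lemma hasSum_besqDensity (hμ : -1 < μ) {t x y : ℝ} (ht : 0 < t) (hx : 0 ≤ x) (hy : 0 < y) :
    HasSum (fun k : ℕ => Real.exp (-(x / (2 * t))) * (x / (2 * t)) ^ k / k.factorial *
      gammaPDFReal (μ + k + 1) (1 / (2 * t)) y) (besqDensity μ t x y) := by
  have hb : 0 < 1 / (2 * t) := by positivity
  rcases hx.eq_or_lt with rfl | hx
  · have h0 : besqDensity μ t 0 y = gammaPDFReal (μ + 1) (1 / (2 * t)) y := by
      rw [besqDensity, if_pos rfl, gammaPDFReal, if_pos hy.le, one_div,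
        Real.inv_rpow (by positivity), Real.rpow_neg (by positivity), add_sub_cancel_right]
      ring_nf
    rw [h0]
    convert! hasSum_single (f := fun k : ℕ => Real.exp (-(0 / (2 * t))) * (0 / (2 * t)) ^ k /
      k.factorial * gammaPDFReal (μ + k + 1) (1 / (2 * t)) y) 0 fun k hk => ?_ using 1
    · simp
    · simp [hk]
  · have hz : 0 < √(x * y) / t := by positivity
    have hsum := (summable_besselI hμ hz).hasSum.mul_left
      (1 / (2 * t) * (y / x) ^ (μ / 2) * Real.exp (-(x + y) / (2 * t)))
    rw [besqDensity, if_neg hx.ne', besselI]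
    refine hsum.congr_fun fun k => ?_
    rw [show x / (2 * t) = x * (1 / (2 * t)) by ring,
      ← besselI_term_eq_poisson_mul_gamma hμ hb hx hy k,
      show -(x + y) / (2 * t) = -(x + y) * (1 / (2 * t)) by ring,
      show √(x * y) / t / 2 = √(x * y) * (1 / (2 * t)) by ring]

lemma gammaMeasure_eq_withDensity_restrict (a r : ℝ) :
    gammaMeasure a r = (volume.restrict (Ioi 0)).withDensity (gammaPDF a r) := by
  rw [gammaMeasure, ← withDensity_indicator measurableSet_Ioi]
  refine withDensity_congr_ae ?_
  filter_upwards [Measure.ae_ne volume (0 : ℝ)] with y hy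
  by_cases h : y ∈ Ioi (0 : ℝ)
  · rw [indicator_of_mem h]
  · rw [indicator_of_notMem h, gammaPDF_of_neg (lt_of_le_of_ne (not_lt.1 h) hy)]

theorem besqTransition_eq_sum_gammaMeasure (hμ : -1 < μ) {t : ℝ≥0} (ht : t ≠ 0) (x : ℝ≥0) :
    besqTransition μ t x = Measure.sum fun k : ℕ =>
      poissonMeasure (x / (2 * t)) {k} • gammaMeasure (μ + k + 1) (1 / (2 * t)) := by
  have ht' : (0 : ℝ) < t := by positivity
  have hw (k : ℕ) : 0 ≤ Real.exp (-(x / (2 * t))) * (x / (2 * t)) ^ k / (k.factorial : ℝ) := by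
    positivity
  have hk (k : ℕ) : 0 < μ + k + 1 := by linarith [k.cast_nonneg (α := ℝ)]
  have hgamma (k : ℕ) : Measurable (gammaPDF (μ + k + 1) (1 / (2 * t))) :=
    (measurable_gammaPDFReal _ _).ennreal_ofReal
  simp only [gammaMeasure_eq_withDensity_restrict, ← withDensity_smul _ (hgamma _)]
  rw [← withDensity_tsum fun k => (hgamma k).const_smul _, besqTransition, if_neg ht]
  refine withDensity_congr_ae ((ae_restrict_iff' measurableSet_Ioi).2 (.of_forall fun y hy => ?_))
  have hdensity := hasSum_besqDensity hμ ht' x.coe_nonneg hy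
  simp only [← hdensity.tsum_eq, tsum_apply (Pi.summable.2 fun _ => ENNReal.summable),
    Pi.smul_apply, smul_eq_mul, poissonMeasure_singleton, gammaPDF]
  rw [ENNReal.ofReal_tsum_of_nonneg (fun k => mul_nonneg (hw k)
    (gammaPDFReal_nonneg (hk k) (by positivity) y)) hdensity.summable]
  refine tsum_congr fun k => ?_
  rw [ENNReal.ofReal_mul (hw k)]
  push_cast
  rfl

lemma lintegral_exp_neg_mul_gammaMeasure {a r l : ℝ} (ha : 0 < a) (hr : 0 < r) (hl : 0 ≤ l) :
    ∫⁻ y, ENNReal.ofReal (Real.exp (-(l * y))) ∂gammaMeasure a r =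
      ENNReal.ofReal ((r / (r + l)) ^ a) := by
  have htilt (y : ℝ) : Real.exp (-(l * y)) * gammaPDFReal a r y =
      (r / (r + l)) ^ a * gammaPDFReal a (r + l) y := by
    rcases lt_or_ge y 0 with hy | hy
    · simp [gammaPDFReal, hy.not_ge]
    · have hrl : (r + l) ^ a ≠ 0 := by positivity
      rw [gammaPDFReal, gammaPDFReal, if_pos hy, if_pos hy, add_mul, neg_add, Real.exp_add,
        Real.div_rpow hr.le (by positivity)]
      field_simp
  have hgamma (r : ℝ) : Measurable (gammaPDF a r) := (measurable_gammaPDFReal a r).ennreal_ofReal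
  rw [gammaMeasure, lintegral_withDensity_eq_lintegral_mul _ (hgamma r) (by fun_prop)]
  calc ∫⁻ y, (gammaPDF a r * fun y => ENNReal.ofReal (Real.exp (-(l * y)))) y
      = ∫⁻ y, ENNReal.ofReal ((r / (r + l)) ^ a) * gammaPDF a (r + l) y := by
        refine lintegral_congr fun y => ?_
        rw [Pi.mul_apply, mul_comm, gammaPDF, gammaPDF, ← ENNReal.ofReal_mul (by positivity),
          htilt, ENNReal.ofReal_mul (by positivity)]
    _ = ENNReal.ofReal ((r / (r + l)) ^ a) := by
        rw [lintegral_const_mul _ (hgamma _), lintegral_gammaPDF_eq_one ha (by positivity), mul_one]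

lemma tsum_poissonMeasure_mul_pow (r q : ℝ≥0) :
    ∑' k : ℕ, poissonMeasure r {k} * (q : ℝ≥0∞) ^ k =
      ENNReal.ofReal (Real.exp (-(r * (1 - q)))) := by
  have hterm (k : ℕ) : poissonMeasure r {k} * (q : ℝ≥0∞) ^ k =
      ENNReal.ofReal (Real.exp (-r) * ((r * q : ℝ) ^ k / k.factorial)) := by
    rw [poissonMeasure_singleton, ← ENNReal.ofReal_coe_nnreal (p := q),
      ← ENNReal.ofReal_pow q.coe_nonneg, ← ENNReal.ofReal_mul (by positivity), mul_pow]
    ring_nf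
  have hsum := NormedSpace.expSeries_div_hasSum_exp (r * q : ℝ)
  rw [← Real.exp_eq_exp_ℝ] at hsum
  simp only [hterm]
  rw [← ENNReal.ofReal_tsum_of_nonneg (fun k => by positivity) (hsum.mul_left _).summable,
    (hsum.mul_left _).tsum_eq, ← Real.exp_add]
  ring_nf

theorem lintegral_exp_neg_mul_besqTransition (hμ : -1 < μ) (t x : ℝ≥0) {l : ℝ} (hl : 0 ≤ l) :
    ∫⁻ y, ENNReal.ofReal (Real.exp (-(l * y))) ∂besqTransition μ t x =
      ENNReal.ofReal ((1 + 2 * t * l) ^ (-(μ + 1)) * Real.exp (-(x * l / (1 + 2 * t * l)))) := by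
  rcases eq_or_ne t 0 with rfl | ht
  · rw [besqTransition, if_pos rfl, lintegral_dirac]
    simp [mul_comm]
  have hk (k : ℕ) : 0 < μ + k + 1 := by linarith [k.cast_nonneg (α := ℝ)]
  lift l to ℝ≥0 using hl
  obtain ⟨q, hq⟩ : ∃ q : ℝ≥0, q = (1 + 2 * t * l)⁻¹ := ⟨_, rfl⟩
  have hq_coe : (q : ℝ) = (1 + 2 * (t : ℝ) * (l : ℝ))⁻¹ := by rw [hq]; push_cast; rfl
  have hq_pos : (0 : ℝ) < q := by rw [hq_coe]; positivity
  have hratio : 1 / (2 * (t : ℝ)) / (1 / (2 * (t : ℝ)) + (l : ℝ)) = q := by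
    rw [hq_coe]
    field_simp
  calc ∫⁻ y, ENNReal.ofReal (Real.exp (-(l * y))) ∂besqTransition μ t x
      = ∑' k : ℕ, ENNReal.ofReal (q ^ (μ + 1)) *
          (poissonMeasure (x / (2 * t)) {k} * (q : ℝ≥0∞) ^ k) := by
        rw [besqTransition_eq_sum_gammaMeasure hμ ht, lintegral_sum_measure]
        refine tsum_congr fun k => ?_
        rw [lintegral_smul_measure,
          lintegral_exp_neg_mul_gammaMeasure (hk k) (by positivity) l.coe_nonneg, hratio,
          smul_eq_mul, add_right_comm, Real.rpow_add_natCast hq_pos.ne',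
          ENNReal.ofReal_mul (by positivity), ENNReal.ofReal_pow hq_pos.le,
          ENNReal.ofReal_coe_nnreal]
        ring
    _ = ENNReal.ofReal (q ^ (μ + 1) * Real.exp (-((x / (2 * t) : ℝ≥0) * (1 - q)))) := by
        rw [ENNReal.tsum_mul_left, tsum_poissonMeasure_mul_pow, ENNReal.ofReal_mul (by positivity)]
    _ = _ := by
        rw [hq_coe, Real.rpow_neg (by positivity), Real.inv_rpow (by positivity)]
        push_cast
        congr 3
        field_simp
        ring

lemma isProbabilityMeasure_besqTransition (hμ : -1 < μ) (t x : ℝ≥0) :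
    IsProbabilityMeasure (besqTransition μ t x) where
  measure_univ := by simpa using lintegral_exp_neg_mul_besqTransition hμ t x le_rfl

lemma measurable_besqTransition (hμ : -1 < μ) (t : ℝ≥0) :
    Measurable fun x : ℝ≥0 => besqTransition μ t x := by
  rcases eq_or_ne t 0 with rfl | ht
  · simp only [besqTransition, if_true]
    exact Measure.measurable_dirac.comp measurable_coe_nnreal_real
  · simp only [besqTransition_eq_sum_gammaMeasure hμ ht, poissonMeasure_singleton]
    refine Measure.measurable_of_measurable_coe _ fun B hB => ?_
    simp only [Measure.sum_apply _ hB, Measure.smul_apply, smul_eq_mul]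
    fun_prop

/-- The Markov kernel `x ↦ Q_t(x, dy)` of the squared Bessel process of index `μ > -1`, on the
half-line `ℝ≥0` of starting points for which `besqTransition` is meaningful. -/
noncomputable def besqKernel (hμ : -1 < μ) (t : ℝ≥0) : Kernel ℝ≥0 ℝ where
  toFun x := besqTransition μ t x
  measurable' := measurable_besqTransition hμ t

lemma besqKernel_apply (hμ : -1 < μ) (t x : ℝ≥0) : besqKernel hμ t x = besqTransition μ t x := rfl

instance (hμ : -1 < μ) (t : ℝ≥0) : IsMarkovKernel (besqKernel hμ t) :=
  ⟨isProbabilityMeasure_besqTransition hμ t⟩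

lemma besqTransition_compl_Ioi {t : ℝ≥0} (ht : t ≠ 0) (x : ℝ) :
    besqTransition μ t x (Ioi 0)ᶜ = 0 := by
  rw [besqTransition, if_neg ht, withDensity_apply _ measurableSet_Ioi.compl,
    Measure.restrict_restrict measurableSet_Ioi.compl, compl_inter_self, Measure.restrict_empty,
    lintegral_zero_measure]

lemma besqDensity_mul_mul {c t x y : ℝ} (hc : 0 < c) (ht : 0 < t) (hx : 0 ≤ x) (hy : 0 < y) :
    c * besqDensity μ (c * t) (c * x) (c * y) = besqDensity μ t x y := by
  rcases hx.eq_or_lt with rfl | hx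
  · have hpow : (2 * (c * t)) ^ (-(μ + 1)) = (2 * t) ^ (-(μ + 1)) * (c ^ μ * c)⁻¹ := by
      rw [← Real.rpow_add_one hc.ne', ← Real.rpow_neg hc.le, mul_left_comm,
        Real.mul_rpow hc.le (by positivity), mul_comm]
    have hexp : -(c * y) / (2 * (c * t)) = -y / (2 * t) := by field_simp
    have : c ^ μ ≠ 0 := by positivity
    rw [besqDensity, besqDensity, mul_zero, if_pos rfl, if_pos rfl, hpow, hexp,
      Real.mul_rpow hc.le hy.le]
    field_simp
  · have hsqrt : √(c * x * (c * y)) / (c * t) = √(x * y) / t := by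
      rw [mul_mul_mul_comm, Real.sqrt_mul (by positivity), Real.sqrt_mul_self hc.le]
      field_simp
    have hexp : -(c * x + c * y) / (2 * (c * t)) = -(x + y) / (2 * t) := by field_simp
    rw [besqDensity, besqDensity, if_neg (by positivity), if_neg hx.ne', hsqrt, hexp,
      mul_div_mul_left _ _ hc.ne']
    field_simp

theorem besqTransition_mul_mul {c : ℝ≥0} (hc : c ≠ 0) (t x : ℝ≥0) :
    besqTransition μ (c * t) (c * x) = (besqTransition μ t x).map fun y : ℝ => c * y := by
  rcases eq_or_ne t 0 with rfl | ht
  · simp [besqTransition, Measure.map_dirac' (measurable_const_mul (c : ℝ))]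
  have hc' : (0 : ℝ) < c := by positivity
  have ht' : (0 : ℝ) < t := by positivity
  refine Measure.ext fun B hB => ?_
  have hB' : MeasurableSet ((fun y : ℝ => c * y) ⁻¹' B) := hB.preimage (measurable_const_mul _)
  have hIoi {y : ℝ} : c * y ∈ Ioi (0 : ℝ) ↔ y ∈ Ioi 0 := mul_pos_iff_of_pos_left hc'
  rw [Measure.map_apply (measurable_const_mul _) hB, besqTransition, besqTransition, if_neg ht,
    if_neg (mul_ne_zero hc ht), withDensity_apply _ hB, withDensity_apply _ hB',
    Measure.restrict_restrict hB, Measure.restrict_restrict hB',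
    ← lintegral_indicator (hB.inter measurableSet_Ioi),
    ← lintegral_indicator (hB'.inter measurableSet_Ioi)]
  conv_lhs => rw [← Real.smul_map_volume_mul_left hc'.ne']
  rw [lintegral_smul_measure, ← Homeomorph.coe_mulLeft₀ (c : ℝ) hc'.ne',
    (Homeomorph.mulLeft₀ (c : ℝ) hc'.ne').measurableEmbedding.lintegral_map, smul_eq_mul,
    ← lintegral_const_mul' _ _ ENNReal.ofReal_ne_top, abs_of_pos hc']
  refine lintegral_congr fun y => ?_
  by_cases hy : y ∈ (fun y : ℝ => c * y) ⁻¹' B ∩ Ioi 0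
  · have hcy : c * y ∈ B ∩ Ioi (0 : ℝ) := ⟨hy.1, hIoi.2 hy.2⟩
    rw [Homeomorph.coe_mulLeft₀, indicator_of_mem hy, indicator_of_mem hcy,
      ← ENNReal.ofReal_mul hc'.le, NNReal.coe_mul, besqDensity_mul_mul hc' ht' x.coe_nonneg hy.2]
  · have hcy : c * y ∉ B ∩ Ioi (0 : ℝ) := fun h => hy ⟨h.1, hIoi.1 h.2⟩
    rw [Homeomorph.coe_mulLeft₀, indicator_of_notMem hy, indicator_of_notMem hcy, mul_zero]

end TransitionFunction

section ResolventZero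

variable {μ : ℝ}

/-- Up to a multiplicative constant, the `1`-resolvent density `∫₀^∞ e⁻ʳ q_r(x, 0) dr` of the
squared Bessel process at the point `0`, taken with respect to the speed measure `y^μ dy`. -/
noncomputable def besqResolventZero (μ x : ℝ) : ℝ≥0∞ :=
  ∫⁻ r in Ioi (0 : ℝ),
    ENNReal.ofReal (Real.exp (-r) * r ^ (-(μ + 1)) * Real.exp (-(x / (2 * r))))

lemma antitone_besqResolventZero (μ : ℝ) : Antitone (besqResolventZero μ) := by
  intro x y hxy
  refine setLIntegral_mono' measurableSet_Ioi fun r (hr : 0 < r) => ?_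
  gcongr

lemma measurable_besqResolventZero (μ : ℝ) : Measurable (besqResolventZero μ) :=
  (antitone_besqResolventZero μ).measurable

lemma rpow_neg_le_mul_exp {p x r : ℝ} (hp : 0 < p) (hx : 0 < x) (hr : 0 < r) :
    r ^ (-p) ≤ (2 * p / x) ^ p * Real.exp (x / (2 * r)) := by
  have hinv : r⁻¹ ≤ 2 * p / x * Real.exp (x / (2 * r) / p) := by
    calc r⁻¹ = 2 * p / x * (x / (2 * r) / p) := by field_simp
      _ ≤ _ := by
        gcongr
        linarith [Real.add_one_le_exp (x / (2 * r) / p)]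
  calc r ^ (-p) = r⁻¹ ^ p := by rw [Real.rpow_neg hr.le, Real.inv_rpow hr.le]
    _ ≤ (2 * p / x * Real.exp (x / (2 * r) / p)) ^ p := by gcongr
    _ = (2 * p / x) ^ p * Real.exp (x / (2 * r)) := by
      rw [Real.mul_rpow (by positivity) (Real.exp_pos _).le, ← Real.exp_mul,
        div_mul_cancel₀ _ hp.ne']

lemma besqResolventZero_lt_top (hμ : -1 < μ) {x : ℝ} (hx : 0 < x) :
    besqResolventZero μ x < ∞ := by
  have hint : IntegrableOn (fun r : ℝ => (2 * (μ + 1) / x) ^ (μ + 1) * Real.exp (-r)) (Ioi 0) :=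
    (integrableOn_exp_neg_Ioi 0).const_mul _
  refine (setLIntegral_mono' measurableSet_Ioi fun r (hr : 0 < r) =>
    ENNReal.ofReal_le_ofReal ?_).trans_lt hint.lintegral_lt_top
  calc Real.exp (-r) * r ^ (-(μ + 1)) * Real.exp (-(x / (2 * r)))
      ≤ Real.exp (-r) * ((2 * (μ + 1) / x) ^ (μ + 1) * Real.exp (x / (2 * r))) *
          Real.exp (-(x / (2 * r))) := by
        gcongr
        exact rpow_neg_le_mul_exp (by linarith) hx hr
    _ = (2 * (μ + 1) / x) ^ (μ + 1) * Real.exp (-r) := by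
        rw [Real.exp_neg (x / (2 * r))]
        field_simp

lemma lintegral_Ioc_inv_eq_top : ∫⁻ r in Ioc (0 : ℝ) 1, ENNReal.ofReal r⁻¹ = ∞ := by
  have hnot : ¬ IntegrableOn (fun r : ℝ => r⁻¹) (Ioc 0 1) := by
    rw [← intervalIntegrable_iff_integrableOn_Ioc_of_le zero_le_one, intervalIntegrable_inv_iff]
    simp
  by_contra hfin
  refine hnot ((lintegral_ofReal_ne_top_iff_integrable measurable_inv.aestronglyMeasurable ?_).1
    hfin)
  exact (ae_restrict_iff' measurableSet_Ioc).2 (.of_forall fun r hr => inv_nonneg.2 hr.1.le)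

lemma besqResolventZero_zero (hμ : 0 ≤ μ) : besqResolventZero μ 0 = ∞ := by
  refine top_unique ?_
  calc ∞ = ENNReal.ofReal (Real.exp (-1)) * ∫⁻ r in Ioc (0 : ℝ) 1, ENNReal.ofReal r⁻¹ := by
        rw [lintegral_Ioc_inv_eq_top, ENNReal.mul_top (by simp [Real.exp_pos])]
    _ = ∫⁻ r in Ioc (0 : ℝ) 1, ENNReal.ofReal (Real.exp (-1) * r⁻¹) := by
        rw [← lintegral_const_mul' _ _ ENNReal.ofReal_ne_top]
        exact lintegral_congr fun r => (ENNReal.ofReal_mul (Real.exp_pos _).le).symm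
    _ ≤ ∫⁻ r in Ioc (0 : ℝ) 1,
        ENNReal.ofReal (Real.exp (-r) * r ^ (-(μ + 1)) * Real.exp (-(0 / (2 * r)))) := by
        refine setLIntegral_mono' measurableSet_Ioc fun r ⟨hr, hr1⟩ => ENNReal.ofReal_le_ofReal ?_
        have hpow : r⁻¹ ≤ r ^ (-(μ + 1)) := by
          rw [← Real.rpow_neg_one]
          exact Real.rpow_le_rpow_of_exponent_ge hr hr1 (by linarith)
        rw [zero_div, neg_zero, Real.exp_zero, mul_one]
        gcongr
    _ ≤ besqResolventZero μ 0 := lintegral_mono_set Ioc_subset_Ioi_self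

lemma tendsto_besqResolventZero (μ : ℝ) :
    Tendsto (fun n : ℕ => besqResolventZero μ (1 / ((n : ℝ) + 1))) atTop
      (𝓝 (besqResolventZero μ 0)) := by
  refine lintegral_tendsto_of_tendsto_of_monotone (fun n => by fun_prop)
    ((ae_restrict_iff' measurableSet_Ioi).2 (.of_forall fun r (hr : 0 < r) n k hnk => ?_))
    (.of_forall fun r => ENNReal.tendsto_ofReal (Tendsto.const_mul _ ?_))
  · dsimp only
    gcongr
  · exact (Real.continuous_exp.tendsto _).comp
      ((tendsto_one_div_add_atTop_nhds_zero_nat (𝕜 := ℝ)).div_const (2 * r)).neg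

lemma exists_lt_besqResolventZero (hμ : 0 ≤ μ) {c : ℝ≥0∞} (hc : c ≠ ∞) :
    ∃ y > 0, c < besqResolventZero μ y := by
  have hlim := tendsto_besqResolventZero μ
  rw [besqResolventZero_zero hμ] at hlim
  obtain ⟨n, hn⟩ := (hlim.eventually (lt_mem_nhds hc.lt_top)).exists
  exact ⟨1 / ((n : ℝ) + 1), by positivity, hn⟩

lemma setLIntegral_Ioi_add_le (f : ℝ → ℝ≥0∞) {u : ℝ} (hu : 0 ≤ u) :
    ∫⁻ r in Ioi (0 : ℝ), f (r + u) ≤ ∫⁻ r in Ioi (0 : ℝ), f r := by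
  rw [← lintegral_indicator measurableSet_Ioi, ← lintegral_indicator measurableSet_Ioi,
    ← lintegral_add_right_eq_self ((Ioi (0 : ℝ)).indicator f) u]
  refine lintegral_mono (indicator_le fun r (hr : 0 < r) => ?_)
  have hru : r + u ∈ Ioi (0 : ℝ) := add_pos_of_pos_of_nonneg hr hu
  rw [indicator_of_mem hru]

theorem exp_neg_mul_lintegral_besqResolventZero_le (hμ : -1 < μ) (u x : ℝ≥0) :
    ENNReal.ofReal (Real.exp (-u)) * ∫⁻ y, besqResolventZero μ y ∂besqTransition μ u x ≤
      besqResolventZero μ x := by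
  have := isProbabilityMeasure_besqTransition hμ u x
  -- By the Laplace transform at `1 / (2 r)`, applying `e⁻ᵘ Q_u` shifts the integrand of
  -- `besqResolventZero` to `r + u`.
  have hlaplace (r : ℝ) (hr : r ∈ Ioi (0 : ℝ)) :
      ENNReal.ofReal (Real.exp (-u)) * ∫⁻ y, ENNReal.ofReal
        (Real.exp (-r) * r ^ (-(μ + 1)) * Real.exp (-(y / (2 * r)))) ∂besqTransition μ u x =
      ENNReal.ofReal (Real.exp (-(r + u)) * (r + u) ^ (-(μ + 1)) *
        Real.exp (-(x / (2 * (r + u))))) := by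
    have hr : 0 < r := hr
    have hru : 1 + 2 * u * (2 * r)⁻¹ = (r + u) / r := by field_simp
    simp only [div_eq_inv_mul _ (2 * r), ENNReal.ofReal_mul
      (show 0 ≤ Real.exp (-r) * r ^ (-(μ + 1)) by positivity)]
    rw [lintegral_const_mul' _ _ ENNReal.ofReal_ne_top,
      lintegral_exp_neg_mul_besqTransition hμ u x (by positivity), hru,
      ← ENNReal.ofReal_mul (by positivity), ← ENNReal.ofReal_mul (by positivity),
      Real.div_rpow (by positivity) hr.le, neg_add r, Real.exp_add]
    have : r ^ (-(μ + 1)) ≠ 0 := by positivity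
    congr 1
    field_simp
  simp only [besqResolventZero]
  rw [lintegral_lintegral_swap (by fun_prop), ← lintegral_const_mul' _ _ ENNReal.ofReal_ne_top,
    setLIntegral_congr_fun measurableSet_Ioi hlaplace]
  exact setLIntegral_Ioi_add_le (fun r => ENNReal.ofReal
    (Real.exp (-r) * r ^ (-(μ + 1)) * Real.exp (-(x / (2 * r))))) u.coe_nonneg

lemma exists_le_exp_neg_mul_besqResolventZero (hμ : 0 ≤ μ) {f : ℝ≥0 → ℝ} (hf : Continuous f)
    {t : ℝ≥0} (ht : f t = 0) {c : ℝ≥0∞} (hc : c ≠ ∞) {q : ℕ → ℝ≥0} (hq : DenseRange q) :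
    ∃ i, c ≤ ENNReal.ofReal (Real.exp (-q i)) * besqResolventZero μ (f (q i)) := by
  obtain ⟨y, hy, hcy⟩ := exists_lt_besqResolventZero hμ
    (ENNReal.mul_ne_top (ENNReal.ofReal_ne_top (r := Real.exp (t + 1))) hc)
  obtain ⟨i, hit, hiy⟩ := hq.exists_mem_open
    (isOpen_Iio.inter (isOpen_Iio.preimage hf) : IsOpen (Iio (t + 1) ∩ f ⁻¹' Iio y))
    ⟨t, lt_add_one t, by simpa [ht] using hy⟩
  have hit' : (q i : ℝ) ≤ t + 1 := mod_cast (mem_Iio.1 hit).le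
  refine ⟨i, ?_⟩
  calc c = ENNReal.ofReal (Real.exp (-(t + 1))) * (ENNReal.ofReal (Real.exp (t + 1)) * c) := by
        rw [← mul_assoc, ← ENNReal.ofReal_mul (Real.exp_pos _).le, ← Real.exp_add,
          neg_add_cancel, Real.exp_zero, ENNReal.ofReal_one, one_mul]
    _ ≤ ENNReal.ofReal (Real.exp (-q i)) * besqResolventZero μ (f (q i)) := by
        gcongr
        exact hcy.le.trans (antitone_besqResolventZero μ (mem_Iio.1 hiy).le)

end ResolventZero

section ConditionalDistribution

variable {Ω 𝓧 𝓨 : Type*} {𝓖 m : MeasurableSpace Ω} [MeasurableSpace 𝓧] [MeasurableSpace 𝓨]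
  {P : Measure Ω} {X : Ω → 𝓧} {Y : Ω → 𝓨} {κ : Kernel 𝓧 𝓨} {A : Set Ω}

lemma measure_inter_eq_setLIntegral_of_condExp [IsFiniteMeasure P] (h𝓖 : 𝓖 ≤ m) {E : Set Ω}
    (hE : MeasurableSet[m] E) {q : Ω → ℝ} (hq : 0 ≤ q) (hcond : P⟦E | 𝓖⟧ =ᵐ[P] q)
    (hA : MeasurableSet[𝓖] A) : P (A ∩ E) = ∫⁻ ω in A, ENNReal.ofReal (q ω) ∂P := by
  have hint : Integrable q P := integrable_condExp.congr hcond
  have hreal : ∫ ω in A, q ω ∂P = P.real (A ∩ E) := by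
    rw [← setIntegral_congr_ae (h𝓖 _ hA) (hcond.mono fun _ h _ => h),
      setIntegral_condExp h𝓖 ((integrable_const 1).indicator hE) hA,
      integral_indicator_const _ hE, smul_eq_mul, mul_one, measureReal_restrict_apply hE,
      inter_comm]
  rw [← ofReal_integral_eq_lintegral_ofReal hint.integrableOn (.of_forall hq), hreal,
    ofReal_measureReal]

lemma hasCondDistrib_restrict_of_condExp [IsFiniteMeasure P] [IsFiniteKernel κ] (h𝓖 : 𝓖 ≤ m)
    (hX : Measurable[𝓖] X) (hY : Measurable[m] Y)
    (hcond : ∀ B, MeasurableSet B → P⟦Y ⁻¹' B | 𝓖⟧ =ᵐ[P] fun ω => (κ (X ω)).real B)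
    (hA : MeasurableSet[𝓖] A) : HasCondDistrib Y X κ (P.restrict A) := by
  have hXm : Measurable[m] X := hX.mono h𝓖 le_rfl
  refine ⟨(hXm.prodMk hY).aemeasurable, Measure.ext_prod fun {B C} hB hC => ?_⟩
  have hpair : (fun ω => (X ω, Y ω)) ⁻¹' (B ×ˢ C) ∩ A = (A ∩ X ⁻¹' B) ∩ Y ⁻¹' C := by
    ext ω
    simp only [mem_inter_iff, mem_preimage, mem_prod]
    tauto
  rw [Measure.map_apply (hXm.prodMk hY) (hB.prod hC),
    Measure.restrict_apply (hXm.prodMk hY (hB.prod hC)), hpair,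
    measure_inter_eq_setLIntegral_of_condExp h𝓖 (hY hC) (fun _ => measureReal_nonneg) (hcond C hC)
      (hA.inter (hX hB)), Measure.compProd_apply_prod hB hC,
    setLIntegral_map hB (κ.measurable_coe hC) hXm, Measure.restrict_restrict (hXm hB), inter_comm]
  exact lintegral_congr fun _ => ofReal_measureReal

lemma lintegral_eq_of_hasCondDistrib [SFinite P] [IsSFiniteKernel κ]
    (h : HasCondDistrib Y X κ P) (hX : Measurable X) {ψ : 𝓧 × 𝓨 → ℝ≥0∞} (hψ : Measurable ψ) :
    ∫⁻ ω, ψ (X ω, Y ω) ∂P = ∫⁻ ω, ∫⁻ y, ψ (X ω, y) ∂κ (X ω) ∂P := by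
  rw [h.lintegral_comp hψ.aemeasurable, Measure.lintegral_compProd hψ,
    lintegral_map hψ.lintegral_kernel_prod_right' hX]

end ConditionalDistribution

section NullAugmentation

variable {Ω : Type*} {m : MeasurableSpace Ω} {P : Measure Ω}

/-- The filtration obtained from `𝓕` by adjoining all `P`-null events of the ambient `σ`-algebra;
its right-continuous version is `usualAugmentation P 𝓕`. -/
def nullAugmentation (P : Measure Ω) (𝓕 : Filtration ℝ≥0 m) : Filtration ℝ≥0 m where
  seq t := 𝓕 t ⊔ MeasurableSpace.generateFrom {N | MeasurableSet[m] N ∧ P N = 0}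
  mono' _ _ hst := sup_le_sup_right (𝓕.mono hst) _
  le' t := sup_le (𝓕.le t) (MeasurableSpace.generateFrom_le fun _ hN => hN.1)

lemma le_nullAugmentation (P : Measure Ω) (𝓕 : Filtration ℝ≥0 m) (t : ℝ≥0) :
    𝓕 t ≤ nullAugmentation P 𝓕 t :=
  le_sup_left

lemma exists_measurableSet_ae_eq_of_nullAugmentation {𝓕 : Filtration ℝ≥0 m} {t : ℝ≥0}
    {A : Set Ω} (hA : MeasurableSet[nullAugmentation P 𝓕 t] A) :
    ∃ A', MeasurableSet[𝓕 t] A' ∧ A =ᵐ[P] A' := by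
  have hle : nullAugmentation P 𝓕 t ≤ eventuallyMeasurableSpace (𝓕 t) (ae P) :=
    sup_le (fun s hs => ⟨s, hs, EventuallyEq.rfl⟩) <| MeasurableSpace.generateFrom_le fun _ hN =>
      ⟨∅, @MeasurableSet.empty _ (𝓕 t), ae_eq_empty.2 hN.2⟩
  exact hle A hA

end NullAugmentation

namespace IsBESQ

variable {Ω : Type*} {m : MeasurableSpace Ω} {P : Measure Ω} {μ x : ℝ} {S : ℝ≥0 → Ω → ℝ}

/-- The filtration `σ(S u : u ≤ t)` generated by a squared Bessel process. -/
abbrev natural (hS : IsBESQ μ x S P) : Filtration ℝ≥0 m :=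
  Filtration.natural S fun u => (hS.measurable u).stronglyMeasurable

lemma measurable_natural (hS : IsBESQ μ x S P) (t : ℝ≥0) : Measurable[hS.natural t] (S t) :=
  (Filtration.stronglyAdapted_natural (fun u => (hS.measurable u).stronglyMeasurable) t).measurable

lemma filtration_eq_rightCont (hS : IsBESQ μ x S P) :
    hS.filtration = (nullAugmentation P hS.natural).rightCont := rfl

lemma measurable_uncurry (hS : IsBESQ μ x S P) : Measurable fun p : ℝ≥0 × Ω => S p.1 p.2 :=
  measurable_uncurry_of_continuous_of_measurable hS.continuous hS.measurable

variable [IsProbabilityMeasure P]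

theorem hasLaw (hS : IsBESQ μ x S P) (t : ℝ≥0) : HasLaw (S t) (besqTransition μ t x) P := by
  have hlaw {B : Set ℝ} (hB : MeasurableSet B) :
      P (S t ⁻¹' B) = ENNReal.ofReal ((besqTransition μ t x).real B) := by
    have h := measure_inter_eq_setLIntegral_of_condExp (hS.natural.le 0)
      (hB.preimage (hS.measurable (0 + t))) (fun _ => measureReal_nonneg) (hS.markov 0 t B hB)
      MeasurableSet.univ
    rw [univ_inter, zero_add, setLIntegral_univ, lintegral_congr_ae
      (hS.start.mono fun ω hω => by rw [hω])] at h
    rwa [lintegral_const, measure_univ, mul_one] at h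
  have : IsFiniteMeasure (besqTransition μ t x) := by
    refine ⟨lt_top_iff_ne_top.2 fun htop => ?_⟩
    simpa [measureReal_def, htop] using hlaw MeasurableSet.univ
  refine ⟨(hS.measurable t).aemeasurable, Measure.ext fun B hB => ?_⟩
  rw [Measure.map_apply (hS.measurable t) hB, hlaw hB, ofReal_measureReal]

lemma ae_pos (hS : IsBESQ μ x S P) {t : ℝ≥0} (h : 0 < x ∨ 0 < t) : ∀ᵐ ω ∂P, 0 < S t ω := by
  rcases eq_or_ne t 0 with rfl | ht
  · filter_upwards [hS.start] with ω hω
    exact hω ▸ h.resolve_right (lt_irrefl _)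
  · exact ((hS.hasLaw t).ae_iff (measurableSet_setOfPred.1 measurableSet_Ioi)).2
      (besqTransition_compl_Ioi ht x)

lemma ae_nonneg (hS : IsBESQ μ x S P) (hx : 0 ≤ x) (t : ℝ≥0) : ∀ᵐ ω ∂P, 0 ≤ S t ω := by
  rcases eq_or_ne t 0 with rfl | ht
  · filter_upwards [hS.start] with ω hω
    exact hω ▸ hx
  · exact (hS.ae_pos (.inr (pos_iff_ne_zero.2 ht))).mono fun _ => le_of_lt

theorem hasCondDistrib (hS : IsBESQ μ x S P) (hμ : -1 < μ) (hx : 0 ≤ x) (s t : ℝ≥0) {A : Set Ω}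
    (hA : MeasurableSet[nullAugmentation P hS.natural s] A) :
    HasCondDistrib (S (s + t)) (fun ω => (S s ω).toNNReal) (besqKernel hμ t) (P.restrict A) := by
  obtain ⟨A', hA', hAA'⟩ := exists_measurableSet_ae_eq_of_nullAugmentation hA
  rw [Measure.restrict_congr_set hAA']
  refine hasCondDistrib_restrict_of_condExp (hS.natural.le s)
    (hS.measurable_natural s).real_toNNReal (hS.measurable _) (fun B hB => ?_) hA'
  filter_upwards [hS.markov s t B hB, hS.ae_nonneg hx s] with ω hω hpos
  rw [hω, besqKernel_apply, Real.coe_toNNReal _ hpos]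

theorem setLIntegral_markov (hS : IsBESQ μ x S P) (hμ : -1 < μ) (hx : 0 ≤ x) (s t : ℝ≥0)
    {A : Set Ω} (hA : MeasurableSet[nullAugmentation P hS.natural s] A) {ψ : ℝ≥0 × ℝ → ℝ≥0∞}
    (hψ : Measurable ψ) :
    ∫⁻ ω in A, ψ ((S s ω).toNNReal, S (s + t) ω) ∂P =
      ∫⁻ ω in A, ∫⁻ y, ψ ((S s ω).toNNReal, y) ∂besqTransition μ t (S s ω).toNNReal ∂P :=
  lintegral_eq_of_hasCondDistrib (hS.hasCondDistrib hμ hx s t hA)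
    (hS.measurable s).real_toNNReal hψ

end IsBESQ

section MaximalInequality

variable {Ω ι : Type*} [LinearOrder ι] {m : MeasurableSpace Ω} {P : Measure Ω}
  {𝓕 : Filtration ι m} {M : ι → Ω → ℝ≥0∞} {s : ι} {A : Set Ω}

lemma mul_measure_exists_mem_finset_le_lintegral (hM : ∀ t, Measurable[𝓕 t] (M t))
    (hsuper : ∀ s t, s ≤ t → ∀ A, MeasurableSet[𝓕 s] A →
      ∫⁻ ω in A, M t ω ∂P ≤ ∫⁻ ω in A, M s ω ∂P)
    (c : ℝ≥0∞) (F : Finset ι) (hs : ∀ t ∈ F, s ≤ t) (hA : MeasurableSet[𝓕 s] A) :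
    c * P (A ∩ {ω | ∃ t ∈ F, c ≤ M t ω}) ≤ ∫⁻ ω in A, M s ω ∂P := by
  induction F using Finset.induction_on_min generalizing s A with
  | empty => simp
  | insert a F ha ih =>
    have hsa : s ≤ a := hs a (Finset.mem_insert_self a F)
    have hAa : MeasurableSet[𝓕 a] A := 𝓕.mono hsa _ hA
    have hlarge : MeasurableSet[𝓕 a] {ω | c ≤ M a ω} := hM a measurableSet_Ici
    have hsplit : A ∩ {ω | ∃ t ∈ insert a F, c ≤ M t ω} ⊆
        A ∩ {ω | c ≤ M a ω} ∪ (A \ {ω | c ≤ M a ω}) ∩ {ω | ∃ t ∈ F, c ≤ M t ω} := by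
      rintro ω ⟨hω, t, ht, hct⟩
      by_cases hca : c ≤ M a ω
      · exact .inl ⟨hω, hca⟩
      · exact .inr ⟨⟨hω, hca⟩, t,
          Finset.mem_of_mem_insert_of_ne ht fun h => hca (h ▸ hct), hct⟩
    calc c * P (A ∩ {ω | ∃ t ∈ insert a F, c ≤ M t ω})
        ≤ c * P (A ∩ {ω | c ≤ M a ω}) +
            c * P ((A \ {ω | c ≤ M a ω}) ∩ {ω | ∃ t ∈ F, c ≤ M t ω}) := by
          rw [← mul_add]
          gcongr
          exact (measure_mono hsplit).trans (measure_union_le _ _)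
      _ ≤ ∫⁻ ω in A ∩ {ω | c ≤ M a ω}, M a ω ∂P + ∫⁻ ω in A \ {ω | c ≤ M a ω}, M a ω ∂P := by
          gcongr
          · rw [← setLIntegral_const]
            exact setLIntegral_mono' (𝓕.le a _ (hAa.inter hlarge)) fun ω hω => hω.2
          · exact ih (fun t ht => (ha t ht).le) (hAa.diff hlarge)
      _ = ∫⁻ ω in A, M a ω ∂P := lintegral_inter_add_sdiff _ _ (𝓕.le a _ hlarge)
      _ ≤ ∫⁻ ω in A, M s ω ∂P := hsuper s a hsa A hA

theorem mul_measure_exists_nat_le_lintegral (hM : ∀ t, Measurable[𝓕 t] (M t))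
    (hsuper : ∀ s t, s ≤ t → ∀ A, MeasurableSet[𝓕 s] A →
      ∫⁻ ω in A, M t ω ∂P ≤ ∫⁻ ω in A, M s ω ∂P)
    (c : ℝ≥0∞) {q : ℕ → ι} (hs : ∀ i, s ≤ q i) :
    c * P {ω | ∃ i, c ≤ M (q i) ω} ≤ ∫⁻ ω, M s ω ∂P := by
  have hmono : Monotone fun n => {ω | ∃ t ∈ (Finset.range n).image q, c ≤ M t ω} :=
    fun n k hnk ω ⟨t, ht, hct⟩ =>
      ⟨t, Finset.image_subset_image (Finset.range_subset_range.2 hnk) ht, hct⟩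
  have hunion : {ω | ∃ i, c ≤ M (q i) ω} =
      ⋃ n, {ω | ∃ t ∈ (Finset.range n).image q, c ≤ M t ω} := by
    ext ω
    simp only [mem_ofPred_eq, mem_iUnion, Finset.mem_image, Finset.mem_range]
    exact ⟨fun ⟨i, hi⟩ => ⟨i + 1, q i, ⟨i, i.lt_succ_self, rfl⟩, hi⟩,
      fun ⟨_, _, ⟨i, _, hi⟩, hc⟩ => ⟨i, hi ▸ hc⟩⟩
  rw [hunion, hmono.measure_iUnion, ENNReal.mul_iSup]
  refine iSup_le fun n => ?_
  have h := mul_measure_exists_mem_finset_le_lintegral hM hsuper c ((Finset.range n).image q)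
    (s := s) (by simpa using fun i _ => hs i) MeasurableSet.univ
  rwa [univ_inter, setLIntegral_univ] at h

end MaximalInequality

namespace IsBESQ

variable {Ω : Type*} {m : MeasurableSpace Ω} {P : Measure Ω} [IsProbabilityMeasure P]
  {μ x : ℝ} {S : ℝ≥0 → Ω → ℝ}

lemma setLIntegral_exp_neg_mul_besqResolventZero_le (hS : IsBESQ μ x S P) (hμ : -1 < μ)
    (hx : 0 ≤ x) {s t : ℝ≥0} (hst : s ≤ t) {A : Set Ω} (hA : MeasurableSet[hS.natural s] A) :
    ∫⁻ ω in A, ENNReal.ofReal (Real.exp (-t)) * besqResolventZero μ (S t ω) ∂P ≤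
      ∫⁻ ω in A, ENNReal.ofReal (Real.exp (-s)) * besqResolventZero μ (S s ω) ∂P := by
  obtain ⟨u, rfl⟩ := exists_add_of_le hst
  have hexp : ENNReal.ofReal (Real.exp (-(s + u : ℝ≥0))) =
      ENNReal.ofReal (Real.exp (-s)) * ENNReal.ofReal (Real.exp (-u)) := by
    rw [← ENNReal.ofReal_mul (Real.exp_pos _).le, ← Real.exp_add, NNReal.coe_add, neg_add]
  have hmarkov := hS.setLIntegral_markov hμ hx s u (le_nullAugmentation P hS.natural s _ hA)
    (ψ := fun z => besqResolventZero μ z.2) ((measurable_besqResolventZero μ).comp measurable_snd)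
  simp only [hexp, mul_assoc]
  rw [lintegral_const_mul' _ _ ENNReal.ofReal_ne_top,
    lintegral_const_mul' _ _ ENNReal.ofReal_ne_top, lintegral_const_mul' _ _ ENNReal.ofReal_ne_top,
    hmarkov, ← lintegral_const_mul' _ _ ENNReal.ofReal_ne_top]
  gcongr 1
  refine lintegral_mono_ae (ae_restrict_of_ae ((hS.ae_nonneg hx s).mono fun ω hω => ?_))
  simpa [Real.coe_toNNReal _ hω] using
    exp_neg_mul_lintegral_besqResolventZero_le hμ u (S s ω).toNNReal

theorem ae_forall_ne_zero (hS : IsBESQ μ x S P) (hμ : 0 ≤ μ) (hx : 0 < x) :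
    ∀ᵐ ω ∂P, ∀ t, S t ω ≠ 0 := by
  have hμ' : -1 < μ := by linarith
  obtain ⟨q, hq⟩ := TopologicalSpace.exists_dense_seq ℝ≥0
  let M (t : ℝ≥0) (ω : Ω) : ℝ≥0∞ :=
    ENNReal.ofReal (Real.exp (-t)) * besqResolventZero μ (S t ω)
  have hM (t : ℝ≥0) : Measurable[hS.natural t] (M t) :=
    ((measurable_besqResolventZero μ).const_mul _).comp (hS.measurable_natural t)
  have hM0 : ∫⁻ ω, M 0 ω ∂P = besqResolventZero μ x := by
    rw [lintegral_congr_ae (hS.start.mono fun ω hω => show M 0 ω = besqResolventZero μ x by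
      simp [M, hω]), lintegral_const, measure_univ, mul_one]
  have hmax (n : ℕ) : n * P {ω | ∃ t, S t ω = 0} ≤ besqResolventZero μ x := by
    calc n * P {ω | ∃ t, S t ω = 0} ≤ n * P {ω | ∃ i, n ≤ M (q i) ω} := by
          gcongr
          exact fun ⟨t, ht⟩ => exists_le_exp_neg_mul_besqResolventZero hμ (hS.continuous _) ht
            (ENNReal.natCast_ne_top n) hq
      _ ≤ ∫⁻ ω, M 0 ω ∂P := mul_measure_exists_nat_le_lintegral hM (fun s t hst A hA =>
          hS.setLIntegral_exp_neg_mul_besqResolventZero_le hμ' hx.le hst hA) n fun i => zero_le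
      _ = besqResolventZero μ x := hM0
  have hzero : P {ω | ∃ t, S t ω = 0} = 0 := by
    by_contra hne
    obtain ⟨n, hn⟩ := ENNReal.exists_nat_mul_gt hne (besqResolventZero_lt_top hμ' hx).ne
    exact hn.not_ge (hmax n)
  exact (measure_eq_zero_iff_ae_notMem.1 hzero).mono fun ω hω t ht => hω ⟨t, ht⟩

theorem ae_forall_pos (hS : IsBESQ μ x S P) (hμ : 0 ≤ μ) (hx : 0 < x) :
    ∀ᵐ ω ∂P, ∀ t, 0 < S t ω := by
  obtain ⟨q, hq⟩ := TopologicalSpace.exists_dense_seq ℝ≥0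
  have hdense : ∀ᵐ ω ∂P, ∀ i, 0 < S (q i) ω := ae_all_iff.2 fun i => hS.ae_pos (.inl hx)
  filter_upwards [hdense, hS.ae_forall_ne_zero hμ hx] with ω hpos hne t
  have hnonneg : 0 ≤ S t ω := by
    by_contra! hneg
    obtain ⟨i, hi⟩ := hq.exists_mem_open (isOpen_Iio.preimage (hS.continuous ω)) ⟨t, hneg⟩
    exact (hpos i).not_gt hi
  exact hnonneg.lt_of_ne' (hne t)

end IsBESQ

section RandomTime

variable {Ω : Type*} {m : MeasurableSpace Ω} {P : Measure Ω} {𝓕 : Filtration ℝ≥0 m}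

/-- The least point of the grid `(n + 1)⁻¹ ℕ` that is strictly larger than `t`. Approximating a
random time by such points from the right makes it a countably valued stopping time. -/
noncomputable def gridCeil (n : ℕ) (t : ℝ≥0) : ℝ≥0 :=
  (⌊t * (n + 1)⌋₊ + 1) / (n + 1)

lemma floor_mul_succ_eq_iff {n k : ℕ} {t : ℝ≥0} :
    ⌊t * (n + 1)⌋₊ = k ↔ (k / (n + 1) : ℝ≥0) ≤ t ∧ t < (k + 1) / (n + 1) := by
  rw [Nat.floor_eq_iff zero_le, div_le_iff₀ (by positivity), lt_div_iff₀ (by positivity)]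

lemma lt_gridCeil (n : ℕ) (t : ℝ≥0) : t < gridCeil n t :=
  (floor_mul_succ_eq_iff.1 rfl).2

lemma measurable_gridCeil (n : ℕ) : Measurable (gridCeil n) := by
  unfold gridCeil
  fun_prop

lemma tendsto_gridCeil (t : ℝ≥0) : Tendsto (fun n => gridCeil n t) atTop (𝓝[>] t) := by
  refine tendsto_nhdsWithin_iff.2 ⟨?_, .of_forall fun n => lt_gridCeil n t⟩
  have hupper : Tendsto (fun n : ℕ => t + 1 / ((n : ℝ≥0) + 1)) atTop (𝓝 t) := by
    simpa using tendsto_const_nhds.add (tendsto_one_div_add_atTop_nhds_zero_nat (𝕜 := ℝ≥0))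
  refine tendsto_of_tendsto_of_tendsto_of_le_of_le tendsto_const_nhds hupper
    (fun n => (lt_gridCeil n t).le) fun n => ?_
  rw [gridCeil, add_div]
  gcongr
  exact (floor_mul_succ_eq_iff.1 rfl).1

variable {τ : Ω → WithTop ℝ≥0} {T : Ω → ℝ≥0} {A : Set Ω} {F G : ℝ≥0 → Ω → ℝ≥0∞}

lemma measurableSet_inter_lt_of_rightCont (hτ : IsStoppingTime 𝓕.rightCont τ)
    (hA : MeasurableSet[hτ.measurableSpace] A) (t : ℝ≥0) :
    MeasurableSet[𝓕 t] (A ∩ {ω | τ ω < t}) := by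
  obtain ⟨q, hq⟩ := TopologicalSpace.exists_dense_seq ℝ≥0
  have hunion : A ∩ {ω | τ ω < t} = ⋃ i, ⋃ (_ : q i < t), A ∩ {ω | τ ω ≤ q i} := by
    ext ω
    simp only [mem_inter_iff, mem_ofPred_eq, mem_iUnion, exists_prop]
    refine ⟨fun ⟨hω, hlt⟩ => ?_, fun ⟨i, hi, hω, hle⟩ =>
      ⟨hω, hle.trans_lt (WithTop.coe_lt_coe.2 hi)⟩⟩
    lift τ ω to ℝ≥0 using hlt.ne_top with s
    obtain ⟨i, hsi, hit⟩ :=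
      hq.exists_mem_open isOpen_Ioo (nonempty_Ioo.2 (WithTop.coe_lt_coe.1 hlt))
    exact ⟨i, hit, hω, WithTop.coe_le_coe.2 hsi.le⟩
  have hle {s : ℝ≥0} (hst : s < t) : 𝓕.rightCont s ≤ 𝓕 t := by
    rw [Filtration.rightCont_eq]
    exact iInf₂_le t hst
  rw [hunion]
  exact .iUnion fun i => .iUnion fun hi => hle hi _ (hA.2 _)

lemma setLIntegral_gridCeil_eq
    (hFG : ∀ t ≠ 0, ∀ B, MeasurableSet[𝓕 t] B → ∫⁻ ω in B, F t ω ∂P = ∫⁻ ω in B, G t ω ∂P)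
    (hA : ∀ t, MeasurableSet[𝓕 t] (A ∩ {ω | T ω < t})) (n : ℕ) :
    ∫⁻ ω in A, F (gridCeil n (T ω)) ω ∂P = ∫⁻ ω in A, G (gridCeil n (T ω)) ω ∂P := by
  let C (k : ℕ) : Set Ω := A ∩ {ω | ⌊T ω * (n + 1)⌋₊ = k}
  have hC (k : ℕ) : MeasurableSet[𝓕 ((k + 1) / (n + 1))] (C k) := by
    have hdiff : C k = (A ∩ {ω | T ω < (k + 1) / (n + 1)}) \ (A ∩ {ω | T ω < k / (n + 1)}) := by
      ext ω
      simp only [C, Set.mem_sdiff, mem_inter_iff, mem_ofPred_eq, floor_mul_succ_eq_iff, ← not_lt]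
      tauto
    have hmono : (k / (n + 1) : ℝ≥0) ≤ (k + 1) / (n + 1) := by gcongr; exact le_self_add
    exact hdiff ▸ (hA _).diff (𝓕.mono hmono _ (hA _))
  have hunion : A = ⋃ k, C k := by
    ext ω
    simp [C]
  have hdisj : Pairwise (Function.onFun Disjoint C) := fun k l hkl =>
    disjoint_left.2 fun ω hk hl => hkl (hk.2.symm.trans hl.2)
  have hgrid (k : ℕ) (H : ℝ≥0 → Ω → ℝ≥0∞) : ∫⁻ ω in C k, H (gridCeil n (T ω)) ω ∂P =
      ∫⁻ ω in C k, H ((k + 1) / (n + 1)) ω ∂P :=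
    setLIntegral_congr_fun (𝓕.le _ _ (hC k)) fun ω ⟨_, (hω : _ = k)⟩ => by simp only [gridCeil, hω]
  rw [hunion, lintegral_iUnion (fun k => 𝓕.le _ _ (hC k)) hdisj,
    lintegral_iUnion (fun k => 𝓕.le _ _ (hC k)) hdisj]
  refine tsum_congr fun k => ?_
  rw [hgrid, hgrid, hFG _ (by positivity) _ (hC k)]

lemma tendsto_setLIntegral_gridCeil [IsFiniteMeasure P] (hT : Measurable T)
    (hF : Measurable fun p : ℝ≥0 × Ω => F p.1 p.2) {C : ℝ≥0} (hFC : ∀ t ω, F t ω ≤ C)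
    (hFT : ∀ᵐ ω ∂P, ContinuousWithinAt (F · ω) (Ioi (T ω)) (T ω)) :
    Tendsto (fun n => ∫⁻ ω in A, F (gridCeil n (T ω)) ω ∂P) atTop
      (𝓝 (∫⁻ ω in A, F (T ω) ω ∂P)) := by
  refine tendsto_lintegral_of_dominated_convergence (fun _ => (C : ℝ≥0∞))
    (fun n => hF.comp (((measurable_gridCeil n).comp hT).prodMk measurable_id))
    (fun n => .of_forall fun ω => hFC _ _) ?_
    (ae_restrict_of_ae (hFT.mono fun ω hω => hω.tendsto.comp (tendsto_gridCeil _)))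
  rw [setLIntegral_const]
  exact ENNReal.mul_ne_top ENNReal.coe_ne_top (measure_ne_top _ _)

theorem setLIntegral_randomTime_eq [IsFiniteMeasure P] (hT : Measurable T)
    (hF : Measurable fun p : ℝ≥0 × Ω => F p.1 p.2) (hG : Measurable fun p : ℝ≥0 × Ω => G p.1 p.2)
    {C : ℝ≥0} (hFC : ∀ t ω, F t ω ≤ C) (hGC : ∀ t ω, G t ω ≤ C)
    (hFT : ∀ᵐ ω ∂P, ContinuousWithinAt (F · ω) (Ioi (T ω)) (T ω))
    (hGT : ∀ᵐ ω ∂P, ContinuousWithinAt (G · ω) (Ioi (T ω)) (T ω))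
    (hFG : ∀ t ≠ 0, ∀ B, MeasurableSet[𝓕 t] B → ∫⁻ ω in B, F t ω ∂P = ∫⁻ ω in B, G t ω ∂P)
    (hA : ∀ t, MeasurableSet[𝓕 t] (A ∩ {ω | T ω < t})) :
    ∫⁻ ω in A, F (T ω) ω ∂P = ∫⁻ ω in A, G (T ω) ω ∂P :=
  tendsto_nhds_unique (tendsto_setLIntegral_gridCeil hT hF hFC hFT) <| by
    simpa only [setLIntegral_gridCeil_eq hFG hA] using tendsto_setLIntegral_gridCeil hT hG hGC hGT

end RandomTime

lemma lintegral_div_besqTransition (μ : ℝ) {c : ℝ≥0} (hc : c ≠ 0) (t : ℝ≥0) {f : ℝ → ℝ≥0∞}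
    (hf : Measurable f) :
    ∫⁻ y, f (y / c) ∂besqTransition μ t c = ∫⁻ y, f y ∂besqTransition μ (t / c) 1 := by
  have hscale : besqTransition μ t c = (besqTransition μ (t / c) 1).map fun y : ℝ => c * y := by
    simpa [mul_div_cancel₀ t hc] using besqTransition_mul_mul (μ := μ) hc (t / c) 1
  have hdiv : Measurable fun y : ℝ => f (y / c) := hf.comp (measurable_id.div_const _)
  rw [hscale, lintegral_map hdiv (measurable_const_mul _)]
  simp only [mul_div_cancel_left₀ _ (NNReal.coe_ne_zero.2 hc)]

section BoundedTestFunction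

variable {𝓨 : Type*} [TopologicalSpace 𝓨] (f : BoundedContinuousFunction 𝓨 ℝ≥0)

lemma coe_apply_le_nndist_zero (y : 𝓨) : (f y : ℝ≥0∞) ≤ nndist f 0 :=
  ENNReal.coe_le_coe.2 (BoundedContinuousFunction.NNReal.upper_bound f y)

lemma lintegral_apply_le_nndist_zero {Ω : Type*} {m : MeasurableSpace Ω} (P : Measure Ω)
    [IsProbabilityMeasure P] (Y : Ω → 𝓨) : ∫⁻ ω, f (Y ω) ∂P ≤ nndist f 0 :=
  (lintegral_mono fun _ => coe_apply_le_nndist_zero f _).trans (by simp)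

end BoundedTestFunction

namespace IsBESQ

variable {Ω Ω' : Type*} {m : MeasurableSpace Ω} {m' : MeasurableSpace Ω'} {P : Measure Ω}
  {P' : Measure Ω'} {μ x : ℝ} {S : ℝ≥0 → Ω → ℝ} {R : ℝ≥0 → Ω' → ℝ}
  {A : Set Ω}

lemma continuousAt_besselTime (hS : IsBESQ μ x S P) (a : ℝ≥0) {t : ℝ≥0} {ω : Ω}
    (hω : S t ω ≠ 0) : ContinuousAt (besselTime S · a ω) t := by
  have hcont := hS.continuous ω
  refine ContinuousAt.div (Continuous.continuousAt ?_) hcont.continuousAt hω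
  exact hcont.comp (continuous_id.add ((continuous_real_toNNReal.comp hcont).const_mul a))

lemma measurable_besselTime (hS : IsBESQ μ x S P) (a : ℝ≥0) :
    Measurable fun p : ℝ≥0 × Ω => besselTime S p.1 a p.2 :=
  (hS.measurable_uncurry.comp ((measurable_fst.add
    (hS.measurable_uncurry.real_toNNReal.const_mul a)).prodMk measurable_snd)).div
      hS.measurable_uncurry

lemma measurable_besselTimeAt (hS : IsBESQ μ x S P) {τ : Ω → WithTop ℝ≥0}
    (hτ : IsStoppingTime hS.filtration τ) (a : ℝ≥0) : Measurable (besselTimeAt S τ a) :=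
  (hS.measurable_besselTime a).comp ((hτ.measurable'.untopD 0).prodMk measurable_id)

variable [IsProbabilityMeasure P]

lemma continuous_lintegral (hS : IsBESQ μ x S P) (f : BoundedContinuousFunction ℝ ℝ≥0) :
    Continuous fun t => ∫⁻ ω, f (S t ω) ∂P := by
  refine continuous_iff_continuousAt.2 fun t =>
    tendsto_lintegral_filter_of_dominated_convergence (fun _ => (nndist f 0 : ℝ≥0∞))
      (.of_forall fun u => (f.continuous.measurable.comp (hS.measurable u)).coe_nnreal_ennreal)
      (.of_forall fun u => .of_forall fun ω => coe_apply_le_nndist_zero f _) (by simp)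
      (.of_forall fun ω => ?_)
  exact ENNReal.tendsto_coe.2 ((f.continuous.comp (hS.continuous ω)).tendsto t)

lemma setLIntegral_markov_div (hS : IsBESQ μ x S P) (hμ : -1 < μ) (hx : 0 ≤ x)
    [IsProbabilityMeasure P'] (hR : IsBESQ μ 1 R P') {t : ℝ≥0} (hpos : ∀ᵐ ω ∂P, 0 < S t ω)
    (d : ℝ≥0) (hA : MeasurableSet[nullAugmentation P hS.natural t] A)
    {f : ℝ → ℝ≥0∞} (hf : Measurable f) :
    ∫⁻ ω in A, f (S (t + d) ω / S t ω) ∂P =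
      ∫⁻ ω in A, ∫⁻ ω', f (R (d / (S t ω).toNNReal) ω') ∂P' ∂P := by
  have hψ : Measurable fun z : ℝ≥0 × ℝ => f (z.2 / z.1) :=
    hf.comp (measurable_snd.div measurable_fst.coe_nnreal_real)
  calc ∫⁻ ω in A, f (S (t + d) ω / S t ω) ∂P
      = ∫⁻ ω in A, f (S (t + d) ω / (S t ω).toNNReal) ∂P :=
        lintegral_congr_ae (ae_restrict_of_ae (hpos.mono fun ω hω => by
          simp only [Real.coe_toNNReal _ hω.le]))
    _ = ∫⁻ ω in A, ∫⁻ y, f (y / (S t ω).toNNReal) ∂besqTransition μ d (S t ω).toNNReal ∂P :=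
        hS.setLIntegral_markov hμ hx t d hA hψ
    _ = ∫⁻ ω in A, ∫⁻ ω', f (R (d / (S t ω).toNNReal) ω') ∂P' ∂P :=
        lintegral_congr_ae (ae_restrict_of_ae (hpos.mono fun ω hω => by
          simp only [lintegral_div_besqTransition μ (Real.toNNReal_pos.2 hω).ne' d hf,
            (hR.hasLaw _).lintegral_comp hf.aemeasurable]))

theorem setLIntegral_besselTime (hS : IsBESQ μ x S P) (hμ : -1 < μ) (hx : 0 ≤ x)
    [IsProbabilityMeasure P'] (hR : IsBESQ μ 1 R P') {t : ℝ≥0} (hpos : ∀ᵐ ω ∂P, 0 < S t ω)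
    (a : ℝ≥0) (hA : MeasurableSet[nullAugmentation P hS.natural t] A)
    (f : BoundedContinuousFunction ℝ ℝ≥0) :
    ∫⁻ ω in A, f (besselTime S t a ω) ∂P = P A * ∫⁻ ω, f (R a ω) ∂P' := by
  have hle := le_nullAugmentation P hS.natural t
  -- Given the past up to `t`, the delay `a * S t` is known: it is a stopping time of the constant
  -- filtration, with respect to which the Markov property at `t` holds for every fixed delay.
  let 𝓖 : Filtration ℝ≥0 m := Filtration.const ℝ≥0 (nullAugmentation P hS.natural t)
    ((nullAugmentation P hS.natural).le t)
  let T (ω : Ω) : ℝ≥0 := a * (S t ω).toNNReal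
  have hT : Measurable[nullAugmentation P hS.natural t] T :=
    ((hS.measurable_natural t).mono hle le_rfl).real_toNNReal.const_mul a
  have hratio : Measurable fun p : ℝ≥0 × Ω => S (t + p.1) p.2 / S t p.2 :=
    (hS.measurable_uncurry.comp ((measurable_fst.const_add t).prodMk measurable_snd)).div
      ((hS.measurable t).comp measurable_snd)
  have hrescaled : Measurable fun p : ℝ≥0 × Ω => p.1 / (S t p.2).toNNReal :=
    measurable_fst.div ((hS.measurable t).comp measurable_snd).real_toNNReal
  have hΨ := hR.continuous_lintegral f
  calc ∫⁻ ω in A, f (besselTime S t a ω) ∂P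
      = ∫⁻ ω in A, ∫⁻ ω', f (R (T ω / (S t ω).toNNReal) ω') ∂P' ∂P :=
        setLIntegral_randomTime_eq (𝓕 := 𝓖) (C := nndist f 0)
          (F := fun d ω => f (S (t + d) ω / S t ω))
          (G := fun d ω => ∫⁻ ω', f (R (d / (S t ω).toNNReal) ω') ∂P')
          (hT.mono (𝓖.le 0) le_rfl) (f.continuous.measurable.comp hratio).coe_nnreal_ennreal
          (hΨ.measurable.comp hrescaled) (fun _ _ => coe_apply_le_nndist_zero f _)
          (fun _ _ => lintegral_apply_le_nndist_zero f P' _)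
          (.of_forall fun ω => ((ENNReal.continuous_coe.comp (f.continuous.comp
            (((hS.continuous ω).comp (continuous_const.add continuous_id)).div_const
              _)))).continuousWithinAt)
          (.of_forall fun ω => (hΨ.comp (continuous_id.div_const _)).continuousWithinAt)
          (fun d _ B hB => hS.setLIntegral_markov_div hμ hx hR hpos d hB
            f.continuous.measurable.coe_nnreal_ennreal)
          (fun d => hA.inter (hT measurableSet_Iio))
    _ = ∫⁻ _ in A, ∫⁻ ω', f (R a ω') ∂P' ∂P :=
        lintegral_congr_ae (ae_restrict_of_ae (hpos.mono fun ω hω => by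
          simp only [T, mul_div_cancel_right₀ a (Real.toNNReal_pos.2 hω).ne']))
    _ = P A * ∫⁻ ω, f (R a ω) ∂P' := by rw [setLIntegral_const, mul_comm]

theorem setLIntegral_besselTimeAt (hS : IsBESQ μ x S P) (hμ : -1 < μ) (hx : 0 ≤ x)
    [IsProbabilityMeasure P'] (hR : IsBESQ μ 1 R P') (a : ℝ≥0) {τ : Ω → WithTop ℝ≥0}
    (hτ : IsStoppingTime hS.filtration τ) (hpos : ∀ᵐ ω ∂P, 0 < S ((τ ω).untopD 0) ω)
    (hA : MeasurableSet[hτ.measurableSpace] A) (f : BoundedContinuousFunction ℝ ℝ≥0) :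
    ∫⁻ ω in A ∩ {ω | τ ω ≠ ⊤}, f (besselTimeAt S τ a ω) ∂P =
      P (A ∩ {ω | τ ω ≠ ⊤}) * ∫⁻ ω, f (R a ω) ∂P' := by
  have hbefore (t : ℝ≥0) : MeasurableSet[nullAugmentation P hS.natural t]
      (A ∩ {ω | τ ω ≠ ⊤} ∩ {ω | (τ ω).untopD 0 < t}) := by
    have heq : A ∩ {ω | τ ω ≠ ⊤} ∩ {ω | (τ ω).untopD 0 < t} = A ∩ {ω | τ ω < t} := by
      ext ω
      simp only [mem_inter_iff, mem_ofPred_eq, and_assoc]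
      exact and_congr_right fun _ => ⟨fun h => (WithTop.untopD_lt_iff h.1).1 h.2,
        fun h => ⟨h.ne_top, (WithTop.untopD_lt_iff h.ne_top).2 h⟩⟩
    exact heq ▸ measurableSet_inter_lt_of_rightCont (hS.filtration_eq_rightCont ▸ hτ) hA t
  rw [mul_comm, ← setLIntegral_const]
  refine setLIntegral_randomTime_eq (C := nndist f 0) (F := fun t ω => f (besselTime S t a ω))
    (G := fun _ _ => ∫⁻ ω', f (R a ω') ∂P') (hτ.measurable'.untopD 0)
    (f.continuous.measurable.comp (hS.measurable_besselTime a)).coe_nnreal_ennreal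
    measurable_const (fun _ _ => coe_apply_le_nndist_zero f _)
    (fun _ _ => lintegral_apply_le_nndist_zero f P' _) (hpos.mono fun ω hω => ?_)
    (.of_forall fun _ => continuousWithinAt_const) (fun t ht B hB => ?_) hbefore
  · exact (ENNReal.continuous_coe.continuousAt.comp (f.continuous.continuousAt.comp
      (hS.continuousAt_besselTime a hω.ne'))).continuousWithinAt
  · rw [hS.setLIntegral_besselTime hμ hx hR (hS.ae_pos (.inr (pos_iff_ne_zero.2 ht))) a hB f,
      setLIntegral_const, mul_comm]

section StoppingTime

variable [IsProbabilityMeasure P'] {τ : Ω → WithTop ℝ≥0}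

theorem measure_inter_besselTimeAt (hS : IsBESQ μ x S P) (hμ : -1 < μ) (hx : 0 ≤ x)
    (hR : IsBESQ μ 1 R P') (a : ℝ≥0) (hτ : IsStoppingTime hS.filtration τ)
    (hpos : ∀ᵐ ω ∂P, 0 < S ((τ ω).untopD 0) ω) (hA : MeasurableSet[hτ.measurableSpace] A)
    {B : Set ℝ} (hB : MeasurableSet B) :
    P (A ∩ {ω | τ ω ≠ ⊤} ∩ {ω | besselTimeAt S τ a ω ∈ B}) =
      P (A ∩ {ω | τ ω ≠ ⊤}) * P' {ω | R a ω ∈ B} := by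
  have hX := hS.measurable_besselTimeAt hτ a
  let A' : Set Ω := A ∩ {ω | τ ω ≠ ⊤}
  have hmap : (P.restrict A').map (besselTimeAt S τ a) = P A' • P'.map (R a) := by
    have : IsFiniteMeasure (P A' • P'.map (R a)) := Measure.smul_finite _ (measure_ne_top _ _)
    refine ext_of_forall_lintegral_eq_of_IsFiniteMeasure fun f => ?_
    have hf : Measurable fun y => (f y : ℝ≥0∞) := f.continuous.measurable.coe_nnreal_ennreal
    rw [lintegral_map hf hX, lintegral_smul_measure, lintegral_map hf (hR.measurable a),
      hS.setLIntegral_besselTimeAt hμ hx hR a hτ hpos hA f, smul_eq_mul]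
  have hmapB := Measure.ext_iff.1 hmap B hB
  rwa [Measure.smul_apply, smul_eq_mul, Measure.map_apply hX hB,
    Measure.map_apply (hR.measurable a) hB, Measure.restrict_apply (hX hB), inter_comm] at hmapB

lemma measure_inter_besselTimeAt_of_ne_top (hS : IsBESQ μ x S P) (hμ : -1 < μ) (hx : 0 ≤ x)
    (hR : IsBESQ μ 1 R P') (a : ℝ≥0) (hτ : IsStoppingTime hS.filtration τ)
    (hfin : ∀ᵐ ω ∂P, τ ω ≠ ⊤) (hpos : ∀ᵐ ω ∂P, 0 < S ((τ ω).untopD 0) ω)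
    (hA : MeasurableSet[hτ.measurableSpace] A) {B : Set ℝ} (hB : MeasurableSet B) :
    P (A ∩ besselTimeAt S τ a ⁻¹' B) = P A * P' (R a ⁻¹' B) := by
  have hAfin : (A ∩ {ω | τ ω ≠ ⊤} : Set Ω) =ᵐ[P] A :=
    inter_ae_eq_left_of_ae_eq_univ (eventuallyEq_univ.2 hfin)
  have h := hS.measure_inter_besselTimeAt hμ hx hR a hτ hpos hA hB
  rwa [measure_congr hAfin,
    measure_congr (hAfin.inter (ae_eq_refl {ω | besselTimeAt S τ a ω ∈ B}))] at h

theorem identDistrib_besselTimeAt (hS : IsBESQ μ x S P) (hμ : -1 < μ) (hx : 0 ≤ x)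
    (hR : IsBESQ μ 1 R P') (a : ℝ≥0) (hτ : IsStoppingTime hS.filtration τ)
    (hfin : ∀ᵐ ω ∂P, τ ω ≠ ⊤) (hpos : ∀ᵐ ω ∂P, 0 < S ((τ ω).untopD 0) ω) :
    IdentDistrib (besselTimeAt S τ a) (R a) P P' := by
  have hX := hS.measurable_besselTimeAt hτ a
  refine ⟨hX.aemeasurable, (hR.measurable a).aemeasurable, Measure.ext fun B hB => ?_⟩
  have h := hS.measure_inter_besselTimeAt_of_ne_top hμ hx hR a hτ hfin hpos
    (@MeasurableSet.univ _ hτ.measurableSpace) hB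
  rwa [univ_inter, measure_univ, one_mul, ← Measure.map_apply hX hB,
    ← Measure.map_apply (hR.measurable a) hB] at h

theorem indep_besselTimeAt (hS : IsBESQ μ x S P) (hμ : -1 < μ) (hx : 0 ≤ x)
    (hR : IsBESQ μ 1 R P') (a : ℝ≥0) (hτ : IsStoppingTime hS.filtration τ)
    (hfin : ∀ᵐ ω ∂P, τ ω ≠ ⊤) (hpos : ∀ᵐ ω ∂P, 0 < S ((τ ω).untopD 0) ω) :
    Indep (MeasurableSpace.comap (besselTimeAt S τ a) inferInstance) hτ.measurableSpace P := by
  rw [Indep_iff]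
  rintro _ A ⟨B, hB, rfl⟩ hA
  rw [inter_comm, mul_comm,
    hS.measure_inter_besselTimeAt_of_ne_top hμ hx hR a hτ hfin hpos hA hB,
    ← (hS.identDistrib_besselTimeAt hμ hx hR a hτ hfin hpos).measure_mem_eq hB]

end StoppingTime

end IsBESQ

theorem mainTheorem12
    {Ω : Type*} {m : MeasurableSpace Ω} (P : Measure Ω) [IsProbabilityMeasure P]
    (μ : ℝ) (hμ : 0 ≤ μ) (R : ℝ≥0 → Ω → ℝ) (hR : IsBESQ μ 1 R P) (a : ℝ≥0) :
    -- the law of `X^{v²}(t, a)`, for any starting point `v²`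
    (∀ {Ω' : Type*} {m' : MeasurableSpace Ω'} (P' : Measure Ω') [IsProbabilityMeasure P']
        (v : ℝ) (Rv : ℝ≥0 → Ω' → ℝ) (t : ℝ≥0),
        0 ≤ v → IsBESQ μ (v ^ 2) Rv P' → (0 < v ∨ 0 < t) →
        IdentDistrib (besselTime Rv t a) (R a) P' P ∧
        ∀ f : ℝ → ℝ≥0∞, Measurable f →
          ∫⁻ ω, f (besselTime Rv t a ω) ∂P' = ∫⁻ ω, f (R a ω) ∂P) ∧
    -- the law of `X(t, a)`, and its independence of `𝓕_t`
    (∀ t : ℝ≥0,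
        IdentDistrib (besselTime R t a) (R a) P P ∧
        Indep (MeasurableSpace.comap (besselTime R t a) inferInstance) (hR.filtration t) P) ∧
    -- the same at a stopping time
    (∀ (τ : Ω → WithTop ℝ≥0) (hτ : IsStoppingTime hR.filtration τ),
        ((∀ᵐ ω ∂P, τ ω ≠ ⊤) →
          IdentDistrib (besselTimeAt R τ a) (R a) P P ∧
          Indep (MeasurableSpace.comap (besselTimeAt R τ a) inferInstance)
            hτ.measurableSpace P) ∧
        ∀ (A : Set Ω) (B : Set ℝ), MeasurableSet[hτ.measurableSpace] A → MeasurableSet B →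
          P (A ∩ {ω | τ ω ≠ ⊤} ∩ {ω | besselTimeAt R τ a ω ∈ B}) =
            P (A ∩ {ω | τ ω ≠ ⊤}) * P {ω | R a ω ∈ B}) := by
  have hμ' : -1 < μ := by linarith
  have hpos (σ : Ω → WithTop ℝ≥0) : ∀ᵐ ω ∂P, 0 < R ((σ ω).untopD 0) ω :=
    (hR.ae_forall_pos hμ one_pos).mono fun ω h => h _
  refine ⟨fun P' _ v Rv t _ hRv hvt => ?_, fun t => ?_, fun τ hτ => ⟨fun hfin => ?_, ?_⟩⟩
  · have hv : 0 < v ^ 2 ∨ 0 < t := hvt.imp_left fun h => pow_pos h 2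
    have hid : IdentDistrib (besselTime Rv t a) (R a) P' P :=
      hRv.identDistrib_besselTimeAt hμ' (sq_nonneg v) hR a (isStoppingTime_const hRv.filtration t)
        (.of_forall fun _ => WithTop.coe_ne_top) (hRv.ae_pos hv)
    exact ⟨hid, fun f hf => (hid.comp hf).lintegral_eq⟩
  · have hfin : ∀ᵐ _ ∂P, (t : WithTop ℝ≥0) ≠ ⊤ := .of_forall fun _ => WithTop.coe_ne_top
    have ht := isStoppingTime_const hR.filtration t
    have hind := hR.indep_besselTimeAt hμ' zero_le_one hR a ht hfin (hpos _)
    rw [IsStoppingTime.measurableSpace_const] at hind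
    exact ⟨hR.identDistrib_besselTimeAt hμ' zero_le_one hR a ht hfin (hpos _), hind⟩
  · exact ⟨hR.identDistrib_besselTimeAt hμ' zero_le_one hR a hτ hfin (hpos τ),
      hR.indep_besselTimeAt hμ' zero_le_one hR a hτ hfin (hpos τ)⟩
  · exact fun A B hA hB =>
      hR.measure_inter_besselTimeAt hμ' zero_le_one hR a hτ (hpos τ) hA hB
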